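/- A residuated lattice is an algebra $(R,\wedge,\vee,\cdot,\backslash,/,1)$ such that $(R,\wedge,\vee)$ is a lattice, $(R,\cdot,1)$ is a monoid, and $xy\le z \iff y\le x\backslash z \iff x\le z/y$ for all $x,y,z\in R$. It is called unilinear if for all $u_1,u_2,z,w\in R$ one has $u_1\le u_2$, or $u_2\le u_1$, or both $u_1\wedge u_2\le w$ and $z\le u_1\vee u_2$. Let $\mathsf{URL}$ be the class of unilinear residuated lattices and let $\mathsf{SRL}$ be the variety it generates; members of $\mathsf{SRL}$ are called semiunilinear. An algebra is finitely subdirectly irreducible (FSI) if its trivial congruence is meet-irreducible: if two congruences intersect in the trivial congruence, then one of them is trivial (so one-element algebras are FSI). Let $\mathbf 2^2$ denote the four-element Boolean algebra, viewed as a residuated lattice whose multiplication is $\wedge$ and whose unit is the top element. A positive universal sentence is the universal closure of a formula built from equations and inequalities between terms by (binary) conjunction and disjunction. Writing its matrix in conjunctive normal form and each inequality $s\le t$ as $1\le s\backslash t$ (and each equation as two inequalities), it is equivalent to a conjunction of the universal closures of clauses "$1\le p_1$ or $\cdots$ or $1\le p_n$" with $n\ge 1$. The left and right conjugates of a term $a$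 by a variable $x$ are $x\backslash ax\wedge 1$ and $xa/x\wedge 1$; iterated conjugates of $a$ are obtained by one or more applications of left and right conjugation by variables. For a set $\phi$ of positive universal sentences, $\mathsf V_\phi$ is the variety of residuated lattices axiomatized by all equations $1=\gamma_1(p_1)\vee\cdots\vee\gamma_n(p_n)$, where "$1\le p_1$ or $\cdots$ or $1\le p_n$" is a clause of a member of $\phi$ and each $\gamma_i(p_i)$ is an iterated conjugate of $p_i$. Theorem. (1) The FSI members of $\mathsf{SRL}$ are precisely the unilinear residuated lattices that are not isomorphic to $\mathbf 2^2$. (2) More generally, for every set $\phi$ of positive universal sentences, the FSI members of $\mathsf{SRL}\cap\mathsf V_\phi$ are precisely the unilinear residuated lattices that satisfy $\phi$ and are not isomorphic to $\mathbf 2^2$. (3) For every such $\phi$, every unilinear residuated lattice that satisfies $\phi$ (including $\mathbf 2^2$, if it satisfies $\phi$) belongs to $\mathsf{SRL}\cap\mathsf V_\phi$. (4) Every semiunilinear residuated lattice is (isomorphic to) a subdirect product of unilinear residuated lattices. -/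

import Mathlib

universe u v

/-- Residuated lattices `(R, ∧, ∨, ·, \, /, 1)`: `ldiv x z` is `x \ z` and `rdiv z y` is `z / y`. -/
class ResiduatedLattice (R : Type u) extends Lattice R, Monoid R where
  ldiv : R → R → R
  rdiv : R → R → R
  mul_le_iff_le_ldiv : ∀ x y z : R, x * y ≤ z ↔ y ≤ ldiv x z
  mul_le_iff_le_rdiv : ∀ x y z : R, x * y ≤ z ↔ x ≤ rdiv z y

namespace ResiduatedLattice

/-- The direct product of a family of residuated lattices, with all operations coordinatewise. -/
instance instPi {ι : Type v} (B : ι → Type u) [∀ i, ResiduatedLattice (B i)] :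
    ResiduatedLattice (∀ i, B i) where
  ldiv x z := fun i => ldiv (x i) (z i)
  rdiv z y := fun i => rdiv (z i) (y i)
  mul_le_iff_le_ldiv x y z :=
    forall_congr' fun i => mul_le_iff_le_ldiv (x i) (y i) (z i)
  mul_le_iff_le_rdiv x y z :=
    forall_congr' fun i => mul_le_iff_le_rdiv (x i) (y i) (z i)

/-- Homomorphisms of residuated lattices. -/
structure IsHom {A : Type u} {B : Type v} [ResiduatedLattice A] [ResiduatedLattice B]
    (f : A → B) : Prop where
  map_inf : ∀ x y, f (x ⊓ y) = f x ⊓ f y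
  map_sup : ∀ x y, f (x ⊔ y) = f x ⊔ f y
  map_mul : ∀ x y, f (x * y) = f x * f y
  map_ldiv : ∀ x y, f (ldiv x y) = ldiv (f x) (f y)
  map_rdiv : ∀ x y, f (rdiv x y) = rdiv (f x) (f y)
  map_one : f 1 = 1

/-- Congruences of a residuated lattice. -/
structure Congruence (A : Type u) [ResiduatedLattice A] extends Setoid A where
  inf_congr : ∀ {a b c d : A}, r a b → r c d → r (a ⊓ c) (b ⊓ d)
  sup_congr : ∀ {a b c d : A}, r a b → r c d → r (a ⊔ c) (b ⊔ d)
  mul_congr : ∀ {a b c d : A}, r a b → r c d → r (a * c) (b * d)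
  ldiv_congr : ∀ {a b c d : A}, r a b → r c d → r (ldiv a c) (ldiv b d)
  rdiv_congr : ∀ {a b c d : A}, r a b → r c d → r (rdiv a c) (rdiv b d)

/-- A congruence is the trivial (identity) congruence. -/
def Congruence.IsTrivial {A : Type u} [ResiduatedLattice A] (θ : Congruence A) : Prop :=
  ∀ x y, θ.r x y → x = y

/-- Finitely subdirectly irreducible: the trivial congruence is meet-irreducible, i.e. if the
intersection of two congruences is trivial then one of them is trivial.
(One-element algebras are included.) -/
def IsFSI (A : Type u) [ResiduatedLattice A] : Prop :=
  ∀ θ ψ : Congruence A, (∀ x y, θ.r x y → ψ.r x y → x = y) → θ.IsTrivial ∨ ψ.IsTrivial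

/-- The class `URL` of unilinear residuated lattices. -/
def IsUnilinear (A : Type u) [ResiduatedLattice A] : Prop :=
  ∀ u₁ u₂ z w : A, u₁ ≤ u₂ ∨ u₂ ≤ u₁ ∨ (u₁ ⊓ u₂ ≤ w ∧ z ≤ u₁ ⊔ u₂)

/-- `A` is (isomorphic to) the four-element Boolean algebra with multiplication the meet.
The unit is then the top element, and residuation forces both divisions to be the Boolean
implication. -/
def IsFourElementBooleanAlgebra (A : Type u) [ResiduatedLattice A] : Prop :=
  Nonempty (A ≃o Bool × Bool) ∧ ∀ x y : A, x * y = x ⊓ y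

/-- Terms in the language of residuated lattices, over countably many variables. -/
inductive Term : Type
  | var : ℕ → Term
  | one : Term
  | inf : Term → Term → Term
  | sup : Term → Term → Term
  | mul : Term → Term → Term
  | ldiv : Term → Term → Term
  | rdiv : Term → Term → Term

/-- The value of a term under an assignment of the variables. -/
def Term.eval {A : Type u} [ResiduatedLattice A] (v : ℕ → A) : Term → A
  | .var n => v n
  | .one => 1
  | .inf s t => s.eval v ⊓ t.eval v
  | .sup s t => s.eval v ⊔ t.eval v
  | .mul s t => s.eval v * t.eval v
  | .ldiv s t => ResiduatedLattice.ldiv (s.eval v) (t.eval v)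
  | .rdiv s t => ResiduatedLattice.rdiv (s.eval v) (t.eval v)

/-- The equation `s = t` is valid in `A`. -/
def SatisfiesEq (A : Type u) [ResiduatedLattice A] (s t : Term) : Prop :=
  ∀ v : ℕ → A, s.eval v = t.eval v

/-- The variety `SRL` generated by the unilinear residuated lattices, i.e. the smallest equational
class containing them: `A` satisfies every equation valid in all unilinear residuated lattices. -/
def IsSemiunilinear (A : Type u) [ResiduatedLattice A] : Prop :=
  ∀ s t : Term,
    (∀ (B : Type u) [ResiduatedLattice B], IsUnilinear B → SatisfiesEq B s t) → SatisfiesEq A s t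

/-- Positive quantifier-free formulas: built from equations and inequalities of terms by
conjunction and disjunction. Such a formula stands for the positive universal sentence that is its
universal closure. -/
inductive PosFormula : Type
  | eq : Term → Term → PosFormula
  | le : Term → Term → PosFormula
  | and : PosFormula → PosFormula → PosFormula
  | or : PosFormula → PosFormula → PosFormula

/-- Truth of a positive formula under an assignment. -/
def PosFormula.Holds {A : Type u} [ResiduatedLattice A] (v : ℕ → A) : PosFormula → Prop
  | .eq s t => s.eval v = t.eval v
  | .le s t => s.eval v ≤ t.eval v
  | .and φ ψ => φ.Holds v ∧ ψ.Holds v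
  | .or φ ψ => φ.Holds v ∨ ψ.Holds v

/-- `A` satisfies the positive universal sentence given by `φ`. -/
def Satisfies (A : Type u) [ResiduatedLattice A] (φ : PosFormula) : Prop :=
  ∀ v : ℕ → A, φ.Holds v

/-- The conjunctive normal form of a positive formula. A clause `[p₁, …, pₙ]` stands for
`1 ≤ p₁ or ⋯ or 1 ≤ pₙ`; the inequality `s ≤ t` is written as `1 ≤ s \ t`. -/
def PosFormula.clauses : PosFormula → List (List Term)
  | .eq s t => [[.ldiv s t], [.ldiv t s]]
  | .le s t => [[.ldiv s t]]
  | .and φ ψ => φ.clauses ++ ψ.clauses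
  | .or φ ψ => φ.clauses.flatMap fun c => ψ.clauses.map fun d => c ++ d

/-- The left conjugate `x \ a x ∧ 1` of `a` by the variable `x`. -/
def leftConjugate (x : ℕ) (a : Term) : Term :=
  .inf (.ldiv (.var x) (.mul a (.var x))) .one

/-- The right conjugate `x a / x ∧ 1` of `a` by the variable `x`. -/
def rightConjugate (x : ℕ) (a : Term) : Term :=
  .inf (.rdiv (.mul (.var x) a) (.var x)) .one

/-- `IsIteratedConjugate a t`: the term `t` arises from `a` by one or more applications of left and
right conjugation by variables. -/
inductive IsIteratedConjugate (a : Term) : Term → Prop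
  | left (x : ℕ) : IsIteratedConjugate a (leftConjugate x a)
  | right (x : ℕ) : IsIteratedConjugate a (rightConjugate x a)
  | stepLeft (x : ℕ) {t : Term} :
      IsIteratedConjugate a t → IsIteratedConjugate a (leftConjugate x t)
  | stepRight (x : ℕ) {t : Term} :
      IsIteratedConjugate a t → IsIteratedConjugate a (rightConjugate x t)

/-- The join of a non-empty list of terms (the value at the empty list is never used, since clauses
are non-empty). -/
def joinTerms : List Term → Term
  | [] => .one
  | [t] => t
  | t :: s :: l => .sup t (joinTerms (s :: l))

theorem clauses_ne_nil (φ : PosFormula) : ∀ c ∈ φ.clauses, c ≠ [] := by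
  induction φ with
  | eq s t => simp [PosFormula.clauses]
  | le s t => simp [PosFormula.clauses]
  | and φ ψ h₁ h₂ =>
    intro c hc
    rcases List.mem_append.1 hc with h | h
    exacts [h₁ c h, h₂ c h]
  | or φ ψ h₁ h₂ =>
    intro c hc
    simp only [PosFormula.clauses, List.mem_flatMap, List.mem_map] at hc
    obtain ⟨a, ha, b, -, rfl⟩ := hc
    simp [h₁ a ha]

/-- The variety `V_Φ`, axiomatized by the equations `1 = γ₁(p₁) ∨ ⋯ ∨ γₙ(pₙ)`, for all clauses
`1 ≤ p₁ or ⋯ or 1 ≤ pₙ` of members of `Φ` and all iterated conjugates `γ₁(p₁), …, γₙ(pₙ)`. -/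
def MemVariety (Φ : Set PosFormula) (A : Type u) [ResiduatedLattice A] : Prop :=
  ∀ φ ∈ Φ, ∀ c ∈ φ.clauses, ∀ g : List Term,
    List.Forall₂ IsIteratedConjugate c g → SatisfiesEq A .one (joinTerms g)

/-- `f` represents `A` as a subdirect product of the family `B`. -/
structure IsSubdirectEmbedding {A : Type u} [ResiduatedLattice A] {ι : Type v} {B : ι → Type u}
    [∀ i, ResiduatedLattice (B i)] (f : A → ∀ i, B i) : Prop where
  isHom : IsHom f
  injective : Function.Injective f
  surjective_proj : ∀ i, Function.Surjective fun a => f a i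

end ResiduatedLattice

/-!
Call `x ≲ y` modulo a submonoid `S` of the negative cone if `p x ≤ y` for some `p ∈ S`. When `S` is
normal, the symmetric part of this preorder is a congruence (`IsNormalNegative.congruence`), and the
products of iterated conjugates of an element `a` form such a submonoid, whose congruence collapses
`a ∧ 1` to `1`.

Suppose that `γ₁(a₁) ∨ ⋯ ∨ γₙ(aₙ) = 1` for all iterated conjugates. This property passes from
conjugates to products of conjugates (`one_le_of_forall_isConjugate`). If now `pᵢ x ≤ y` with `pᵢ` a
product of conjugates of `aᵢ`, for each `i`, then every `pᵢ` lies below `y / x`, so that `1 ≤ y / x`,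
i.e. `x ≤ y`: the `n` congruences intersect trivially. In an FSI algebra one of them is therefore
trivial, which means `1 ≤ aᵢ` (`IsFSI.exists_one_le`). Since conjugating variables can be chosen
fresh, the equations of `V_Φ` provide this hypothesis, and FSI members of `V_Φ` satisfy `Φ`
(`IsFSI.satisfies`). Conversely `Φ` implies the equations in any residuated lattice, because a
conjugate of an element above `1` is `1` and all other conjugates are at most `1`
(`memVariety_of_satisfies`).

Unilinearity is itself a positive universal sentence, so its equations hold throughout the variety
generated by the unilinear residuated lattices, and the FSI members of that variety are unilinear.
In the other direction, two non-trivial congruences of a unilinear algebra with trivial intersection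
yield `a, b < 1` with `a ∨ b = 1`, and multiplying by `1 = a ∨ b` leaves room for four elements only
(`IsUnilinear.isFourElementBooleanAlgebra`). The four-element Boolean algebra is not FSI because of
its two projections. Subdirect representability is Birkhoff's theorem: quotients by congruences that
are maximal for separating two given points are FSI, hence unilinear if the algebra is
semiunilinear.
-/

namespace ResiduatedLattice

/-! ### Arithmetic of residuated lattices -/

section Arithmetic

variable {A : Type u} [ResiduatedLattice A]

instance instMulLeftMono : MulLeftMono A :=
  ⟨fun x _ z h => (mul_le_iff_le_ldiv x _ _).2 (h.trans ((mul_le_iff_le_ldiv x z _).1 le_rfl))⟩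

instance instMulRightMono : MulRightMono A :=
  ⟨fun x _ z h => (mul_le_iff_le_rdiv _ x _).2 (h.trans ((mul_le_iff_le_rdiv z x _).1 le_rfl))⟩

theorem mul_ldiv_le (x z : A) : x * ldiv x z ≤ z :=
  (mul_le_iff_le_ldiv _ _ _).2 le_rfl

theorem rdiv_mul_le (z y : A) : rdiv z y * y ≤ z :=
  (mul_le_iff_le_rdiv _ _ _).2 le_rfl

theorem one_le_ldiv_iff {x y : A} : 1 ≤ ldiv x y ↔ x ≤ y := by
  rw [← mul_le_iff_le_ldiv, mul_one]

theorem mul_sup_le {x y z w : A} (hy : x * y ≤ w) (hz : x * z ≤ w) : x * (y ⊔ z) ≤ w := by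
  rw [mul_le_iff_le_ldiv] at *
  exact sup_le hy hz

theorem sup_mul_le {x y z w : A} (hx : x * z ≤ w) (hy : y * z ≤ w) : (x ⊔ y) * z ≤ w := by
  rw [mul_le_iff_le_rdiv] at *
  exact sup_le hx hy

theorem ldiv_inf_one_eq_one_iff {x y : A} : ldiv x y ⊓ 1 = 1 ↔ x ≤ y := by
  rw [inf_eq_right, one_le_ldiv_iff]

end Arithmetic

/-! ### Homomorphisms and quotients -/

section Quotients

variable {A : Type u} [ResiduatedLattice A]

theorem IsHom.eval_comp {B : Type v} [ResiduatedLattice B] {f : A → B} (hf : IsHom f)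
    (v : ℕ → A) (t : Term) : t.eval (fun n => f (v n)) = f (t.eval v) := by
  induction t with
  | var n => rfl
  | one => exact hf.map_one.symm
  | inf s t hs ht => simp only [Term.eval, hs, ht, hf.map_inf]
  | sup s t hs ht => simp only [Term.eval, hs, ht, hf.map_sup]
  | mul s t hs ht => simp only [Term.eval, hs, ht, hf.map_mul]
  | ldiv s t hs ht => simp only [Term.eval, hs, ht, hf.map_ldiv]
  | rdiv s t hs ht => simp only [Term.eval, hs, ht, hf.map_rdiv]

theorem SatisfiesEq.of_surjective {B : Type v} [ResiduatedLattice B] {f : A → B} (hf : IsHom f)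
    (hs : Function.Surjective f) {s t : Term} (h : SatisfiesEq A s t) : SatisfiesEq B s t := by
  intro v
  obtain ⟨w, hw⟩ := hs.comp_left v
  obtain rfl : (fun n => f (w n)) = v := hw
  rw [hf.eval_comp, hf.eval_comp, h w]

namespace Congruence

variable (θ : Congruence A)

/-- The quotient of a residuated lattice by a congruence. -/
def Quot : Type u := Quotient θ.toSetoid

/-- The class of an element modulo a congruence. -/
def toQuot (a : A) : θ.Quot := Quotient.mk θ.toSetoid a

theorem toQuot_surjective : Function.Surjective θ.toQuot := Quotient.mk_surjective

variable {θ} in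
theorem toQuot_eq_toQuot {a b : A} : θ.toQuot a = θ.toQuot b ↔ θ.r a b := Quotient.eq (r := θ.toSetoid)

instance : Max θ.Quot := ⟨Quotient.map₂ (· ⊔ ·) fun _ _ h _ _ h' => θ.sup_congr h h'⟩
instance : Min θ.Quot := ⟨Quotient.map₂ (· ⊓ ·) fun _ _ h _ _ h' => θ.inf_congr h h'⟩
instance : Mul θ.Quot := ⟨Quotient.map₂ (· * ·) fun _ _ h _ _ h' => θ.mul_congr h h'⟩
instance : One θ.Quot := ⟨θ.toQuot 1⟩

theorem toQuot_sup (a b : A) : θ.toQuot a ⊔ θ.toQuot b = θ.toQuot (a ⊔ b) := rfl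
theorem toQuot_inf (a b : A) : θ.toQuot a ⊓ θ.toQuot b = θ.toQuot (a ⊓ b) := rfl
theorem toQuot_mul (a b : A) : θ.toQuot a * θ.toQuot b = θ.toQuot (a * b) := rfl
theorem toQuot_one : (1 : θ.Quot) = θ.toQuot 1 := rfl

instance : Lattice θ.Quot :=
  Lattice.mk'
    (by
      intro a b
      obtain ⟨a, rfl⟩ := θ.toQuot_surjective a
      obtain ⟨b, rfl⟩ := θ.toQuot_surjective b
      simp only [toQuot_sup, sup_comm])
    (by
      intro a b c
      obtain ⟨a, rfl⟩ := θ.toQuot_surjective a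
      obtain ⟨b, rfl⟩ := θ.toQuot_surjective b
      obtain ⟨c, rfl⟩ := θ.toQuot_surjective c
      simp only [toQuot_sup, sup_assoc])
    (by
      intro a b
      obtain ⟨a, rfl⟩ := θ.toQuot_surjective a
      obtain ⟨b, rfl⟩ := θ.toQuot_surjective b
      simp only [toQuot_inf, inf_comm])
    (by
      intro a b c
      obtain ⟨a, rfl⟩ := θ.toQuot_surjective a
      obtain ⟨b, rfl⟩ := θ.toQuot_surjective b
      obtain ⟨c, rfl⟩ := θ.toQuot_surjective c
      simp only [toQuot_inf, inf_assoc])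
    (by
      intro a b
      obtain ⟨a, rfl⟩ := θ.toQuot_surjective a
      obtain ⟨b, rfl⟩ := θ.toQuot_surjective b
      simp only [toQuot_inf, toQuot_sup, sup_inf_self])
    (by
      intro a b
      obtain ⟨a, rfl⟩ := θ.toQuot_surjective a
      obtain ⟨b, rfl⟩ := θ.toQuot_surjective b
      simp only [toQuot_inf, toQuot_sup, inf_sup_self])

variable {θ} in
theorem toQuot_le_toQuot {a b : A} : θ.toQuot a ≤ θ.toQuot b ↔ θ.r (a ⊔ b) b :=
  sup_eq_right.symm.trans (toQuot_eq_toQuot (a := a ⊔ b))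

theorem toQuot_mono : Monotone θ.toQuot := by
  intro a b h
  rw [toQuot_le_toQuot, sup_eq_right.2 h]

instance : Monoid θ.Quot where
  mul_assoc a b c := by
    obtain ⟨a, rfl⟩ := θ.toQuot_surjective a
    obtain ⟨b, rfl⟩ := θ.toQuot_surjective b
    obtain ⟨c, rfl⟩ := θ.toQuot_surjective c
    simp only [toQuot_mul, mul_assoc]
  one_mul a := by
    obtain ⟨a, rfl⟩ := θ.toQuot_surjective a
    simp only [toQuot_one, toQuot_mul, one_mul]
  mul_one a := by
    obtain ⟨a, rfl⟩ := θ.toQuot_surjective a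
    simp only [toQuot_one, toQuot_mul, mul_one]

/-- Residuation passes to the quotient because it is equivalent to the inequalities
`y ≤ x \ (x y ∨ z)` and `x (x \ z) ≤ z`, together with their mirror images. -/
instance : ResiduatedLattice θ.Quot where
  ldiv := Quotient.map₂ ldiv fun _ _ h _ _ h' => θ.ldiv_congr h h'
  rdiv := Quotient.map₂ rdiv fun _ _ h _ _ h' => θ.rdiv_congr h h'
  mul_le_iff_le_ldiv x y z := by
    obtain ⟨x, rfl⟩ := θ.toQuot_surjective x
    obtain ⟨y, rfl⟩ := θ.toQuot_surjective y
    obtain ⟨z, rfl⟩ := θ.toQuot_surjective z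
    change θ.toQuot (x * y) ≤ θ.toQuot z ↔ θ.toQuot y ≤ θ.toQuot (ldiv x z)
    constructor
    · intro h
      have h₁ : y ≤ ldiv x (x * y ⊔ z) := (mul_le_iff_le_ldiv _ _ _).1 le_sup_left
      exact (θ.toQuot_mono h₁).trans_eq
        (toQuot_eq_toQuot.2 (θ.ldiv_congr (θ.refl x) (toQuot_le_toQuot.1 h)))
    · intro h
      have h₁ : x * y ≤ x * (y ⊔ ldiv x z) := mul_le_mul_right le_sup_left x
      exact ((θ.toQuot_mono h₁).trans_eq
        (toQuot_eq_toQuot.2 (θ.mul_congr (θ.refl x) (toQuot_le_toQuot.1 h)))).trans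
        (θ.toQuot_mono (mul_ldiv_le x z))
  mul_le_iff_le_rdiv x y z := by
    obtain ⟨x, rfl⟩ := θ.toQuot_surjective x
    obtain ⟨y, rfl⟩ := θ.toQuot_surjective y
    obtain ⟨z, rfl⟩ := θ.toQuot_surjective z
    change θ.toQuot (x * y) ≤ θ.toQuot z ↔ θ.toQuot x ≤ θ.toQuot (rdiv z y)
    constructor
    · intro h
      have h₁ : x ≤ rdiv (x * y ⊔ z) y := (mul_le_iff_le_rdiv _ _ _).1 le_sup_left
      exact (θ.toQuot_mono h₁).trans_eq
        (toQuot_eq_toQuot.2 (θ.rdiv_congr (toQuot_le_toQuot.1 h) (θ.refl y)))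
    · intro h
      have h₁ : x * y ≤ (x ⊔ rdiv z y) * y := mul_le_mul_left le_sup_left y
      exact ((θ.toQuot_mono h₁).trans_eq
        (toQuot_eq_toQuot.2 (θ.mul_congr (toQuot_le_toQuot.1 h) (θ.refl y)))).trans
        (θ.toQuot_mono (rdiv_mul_le z y))

theorem isHom_toQuot : IsHom θ.toQuot :=
  ⟨fun _ _ => rfl, fun _ _ => rfl, fun _ _ => rfl, fun _ _ => rfl, fun _ _ => rfl, rfl⟩

/-- The inverse image of a congruence under a homomorphism. -/
def comap {B : Type v} [ResiduatedLattice B] {f : A → B} (hf : IsHom f) (ψ : Congruence B) :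
    Congruence A where
  toSetoid := ψ.toSetoid.comap f
  inf_congr {a b c d} h h' := by
    change ψ.r (f (a ⊓ c)) (f (b ⊓ d))
    rw [hf.map_inf, hf.map_inf]
    exact ψ.inf_congr h h'
  sup_congr {a b c d} h h' := by
    change ψ.r (f (a ⊔ c)) (f (b ⊔ d))
    rw [hf.map_sup, hf.map_sup]
    exact ψ.sup_congr h h'
  mul_congr {a b c d} h h' := by
    change ψ.r (f (a * c)) (f (b * d))
    rw [hf.map_mul, hf.map_mul]
    exact ψ.mul_congr h h'
  ldiv_congr {a b c d} h h' := by
    change ψ.r (f (ldiv a c)) (f (ldiv b d))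
    rw [hf.map_ldiv, hf.map_ldiv]
    exact ψ.ldiv_congr h h'
  rdiv_congr {a b c d} h h' := by
    change ψ.r (f (rdiv a c)) (f (rdiv b d))
    rw [hf.map_rdiv, hf.map_rdiv]
    exact ψ.rdiv_congr h h'

/-- Congruences are ordered by inclusion. -/
instance : Preorder (Congruence A) := Preorder.lift fun θ => θ.r

variable (A) in
/-- The identity congruence. -/
def identity : Congruence A where
  toSetoid := ⊥
  inf_congr := by rintro a _ c _ rfl rfl; rfl
  sup_congr := by rintro a _ c _ rfl rfl; rfl
  mul_congr := by rintro a _ c _ rfl rfl; rfl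
  ldiv_congr := by rintro a _ c _ rfl rfl; rfl
  rdiv_congr := by rintro a _ c _ rfl rfl; rfl

/-- The intersection of a set of congruences. -/
def sInter (S : Set (Congruence A)) : Congruence A where
  r x y := ∀ θ ∈ S, θ.r x y
  iseqv := ⟨fun _ θ _ => θ.refl _, fun h θ hθ => θ.symm (h θ hθ),
    fun h h' θ hθ => θ.trans (h θ hθ) (h' θ hθ)⟩
  inf_congr h h' θ hθ := θ.inf_congr (h θ hθ) (h' θ hθ)
  sup_congr h h' θ hθ := θ.sup_congr (h θ hθ) (h' θ hθ)
  mul_congr h h' θ hθ := θ.mul_congr (h θ hθ) (h' θ hθ)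
  ldiv_congr h h' θ hθ := θ.ldiv_congr (h θ hθ) (h' θ hθ)
  rdiv_congr h h' θ hθ := θ.rdiv_congr (h θ hθ) (h' θ hθ)

theorem exists_common_of_isChain {c : Set (Congruence A)} (hc : IsChain (· ≤ ·) c)
    {a b a' b' : A} (h : ∃ θ ∈ c, θ.r a b) (h' : ∃ θ ∈ c, θ.r a' b') :
    ∃ θ ∈ c, θ.r a b ∧ θ.r a' b' := by
  obtain ⟨θ, hθ, h⟩ := h
  obtain ⟨ψ, hψ, h'⟩ := h'
  rcases hc.total hθ hψ with hle | hle
  · exact ⟨ψ, hψ, hle _ _ h, h'⟩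
  · exact ⟨θ, hθ, h, hle _ _ h'⟩

/-- The union of a non-empty chain of congruences. -/
def chainUnion (c : Set (Congruence A)) (hc : IsChain (· ≤ ·) c) (hne : c.Nonempty) :
    Congruence A where
  r x y := ∃ θ ∈ c, θ.r x y
  iseqv := by
    refine ⟨fun _ => ?_, fun ⟨θ, hθ, h⟩ => ⟨θ, hθ, θ.symm h⟩, fun h h' => ?_⟩
    · obtain ⟨θ, hθ⟩ := hne
      exact ⟨θ, hθ, θ.refl _⟩
    · obtain ⟨θ, hθ, h, h'⟩ := exists_common_of_isChain hc h h'
      exact ⟨θ, hθ, θ.trans h h'⟩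
  inf_congr h h' := by
    obtain ⟨θ, hθ, h, h'⟩ := exists_common_of_isChain hc h h'
    exact ⟨θ, hθ, θ.inf_congr h h'⟩
  sup_congr h h' := by
    obtain ⟨θ, hθ, h, h'⟩ := exists_common_of_isChain hc h h'
    exact ⟨θ, hθ, θ.sup_congr h h'⟩
  mul_congr h h' := by
    obtain ⟨θ, hθ, h, h'⟩ := exists_common_of_isChain hc h h'
    exact ⟨θ, hθ, θ.mul_congr h h'⟩
  ldiv_congr h h' := by
    obtain ⟨θ, hθ, h, h'⟩ := exists_common_of_isChain hc h h'
    exact ⟨θ, hθ, θ.ldiv_congr h h'⟩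
  rdiv_congr h h' := by
    obtain ⟨θ, hθ, h, h'⟩ := exists_common_of_isChain hc h h'
    exact ⟨θ, hθ, θ.rdiv_congr h h'⟩

theorem exists_maximal_not_rel {x y : A} (hxy : x ≠ y) :
    ∃ θ : Congruence A, Maximal (fun θ => ¬ θ.r x y) θ := by
  obtain ⟨θ, -, hθ⟩ := zorn_le_nonempty₀ {θ : Congruence A | ¬ θ.r x y}
    (fun c hcs hc ψ hψ => ⟨chainUnion c hc ⟨ψ, hψ⟩, fun ⟨θ, hθ, h⟩ => hcs hθ h,
      fun θ hθ _ _ h => ⟨θ, hθ, h⟩⟩) (identity A) hxy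
  exact ⟨θ, hθ⟩

theorem isFSI_quot_of_maximal {x y : A} {θ : Congruence A}
    (hθ : Maximal (fun θ => ¬ θ.r x y) θ) : IsFSI θ.Quot := by
  have key : ∀ α : Congruence θ.Quot, ¬ α.r (θ.toQuot x) (θ.toQuot y) → α.IsTrivial := by
    intro α hα a b hab
    obtain ⟨a, rfl⟩ := θ.toQuot_surjective a
    obtain ⟨b, rfl⟩ := θ.toQuot_surjective b
    have hle : θ ≤ α.comap θ.isHom_toQuot := fun c d h => by
      change α.r (θ.toQuot c) (θ.toQuot d)
      rw [toQuot_eq_toQuot.2 h]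
    exact toQuot_eq_toQuot.2 (hθ.2 (y := α.comap θ.isHom_toQuot) hα hle a b hab)
  intro α β h
  by_contra! hαβ
  exact hθ.1 (toQuot_eq_toQuot.1 (h _ _ (not_not.1 fun h => hαβ.1 (key α h))
    (not_not.1 fun h => hαβ.2 (key β h))))

end Congruence

/-- Birkhoff's subdirect representation, with finitely subdirectly irreducible factors: for each
pair `x ≠ y` the factor is the quotient by a maximal congruence separating `x` and `y`. -/
theorem exists_subdirectEmbedding_isFSI (A : Type u) [ResiduatedLattice A] :
    ∃ (ι : Type u) (θ : ι → Congruence A), (∀ i, IsFSI (θ i).Quot) ∧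
      IsSubdirectEmbedding fun a i => (θ i).toQuot a := by
  choose θ hθ using fun p : {p : A × A // p.1 ≠ p.2} => Congruence.exists_maximal_not_rel p.2
  refine ⟨_, θ, fun i => Congruence.isFSI_quot_of_maximal (hθ i), ?_, ?_, ?_⟩
  · exact ⟨fun _ _ => rfl, fun _ _ => rfl, fun _ _ => rfl, fun _ _ => rfl, fun _ _ => rfl, rfl⟩
  · intro x y h
    by_contra hxy
    exact (hθ ⟨(x, y), hxy⟩).1 (Congruence.toQuot_eq_toQuot.1 (congrFun h ⟨(x, y), hxy⟩))
  · exact fun i => (θ i).toQuot_surjective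

theorem IsFSI.exists_isTrivial (hA : IsFSI A) :
    ∀ L : List (Congruence A), L ≠ [] →
      (∀ x y, (∀ θ ∈ L, θ.r x y) → x = y) → ∃ θ ∈ L, θ.IsTrivial
  | [], h, _ => absurd rfl h
  | [θ], _, h => ⟨θ, by simp, fun x y hxy => h x y (by simpa using hxy)⟩
  | θ :: ψ :: L, _, h => by
    rcases hA θ (Congruence.sInter {χ | χ ∈ ψ :: L}) fun x y h₁ h₂ =>
      h x y (List.forall_mem_cons.2 ⟨h₁, h₂⟩) with h₁ | h₁
    · exact ⟨θ, by simp, h₁⟩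
    · obtain ⟨χ, hχ, hχt⟩ := hA.exists_isTrivial (ψ :: L) (by simp) h₁
      exact ⟨χ, List.mem_cons_of_mem _ hχ, hχt⟩

end Quotients

/-! ### Congruences from normal submonoids of the negative cone -/

section Normal

variable {A : Type u} [ResiduatedLattice A]

/-- A submonoid `S` of the negative cone is normal if left translates and right translates by its
members are mutually cofinal: every `x p` lies above some `q x`, and every `p x` above some
`x q`. Neither convexity nor closure under meets is required. -/
structure IsNormalNegative (S : Submonoid A) : Prop where
  le_one : ∀ p ∈ S, p ≤ 1
  exists_mul_le_left : ∀ p ∈ S, ∀ x, ∃ q ∈ S, q * x ≤ x * p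
  exists_mul_le_right : ∀ p ∈ S, ∀ x, ∃ q ∈ S, x * q ≤ p * x

/-- The preorder `x ≲ y` given by `p x ≤ y` for some `p ∈ S`. -/
def BelowMod (S : Submonoid A) (x y : A) : Prop := ∃ p ∈ S, p * x ≤ y

namespace BelowMod

variable {S : Submonoid A} {x y z w : A}

theorem of_le (h : x ≤ y) : BelowMod S x y := ⟨1, S.one_mem, by rwa [one_mul]⟩

theorem trans (h : BelowMod S x y) (h' : BelowMod S y z) : BelowMod S x z := by
  obtain ⟨p, hp, h⟩ := h
  obtain ⟨q, hq, h'⟩ := h'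
  refine ⟨q * p, S.mul_mem hq hp, ?_⟩
  rw [mul_assoc]
  exact (mul_le_mul_right h q).trans h'

theorem exists_common (hS : IsNormalNegative S) (h : BelowMod S x y) (h' : BelowMod S z w) :
    ∃ p ∈ S, p * x ≤ y ∧ p * z ≤ w := by
  obtain ⟨p, hp, h⟩ := h
  obtain ⟨q, hq, h'⟩ := h'
  exact ⟨p * q, S.mul_mem hp hq,
    (mul_le_mul_left (mul_le_of_le_one_right' (hS.le_one q hq)) x).trans h,
    (mul_le_mul_left (mul_le_of_le_one_left' (hS.le_one p hp)) z).trans h'⟩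

theorem inf (hS : IsNormalNegative S) (h : BelowMod S x y) (h' : BelowMod S z w) :
    BelowMod S (x ⊓ z) (y ⊓ w) := by
  obtain ⟨p, hp, h, h'⟩ := exists_common hS h h'
  exact ⟨p, hp, le_inf ((mul_le_mul_right inf_le_left p).trans h)
    ((mul_le_mul_right inf_le_right p).trans h')⟩

theorem sup (hS : IsNormalNegative S) (h : BelowMod S x y) (h' : BelowMod S z w) :
    BelowMod S (x ⊔ z) (y ⊔ w) := by
  obtain ⟨p, hp, h, h'⟩ := exists_common hS h h'
  exact ⟨p, hp, mul_sup_le (h.trans le_sup_left) (h'.trans le_sup_right)⟩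

theorem mul (hS : IsNormalNegative S) (h : BelowMod S x y) (h' : BelowMod S z w) :
    BelowMod S (x * z) (y * w) := by
  obtain ⟨m, hm, h⟩ := h
  obtain ⟨n, hn, h'⟩ := h'
  obtain ⟨q, hq, hqx⟩ := hS.exists_mul_le_left n hn x
  refine ⟨m * q, S.mul_mem hm hq, ?_⟩
  calc m * q * (x * z) = m * (q * x) * z := by simp only [mul_assoc]
    _ ≤ m * (x * n) * z := by gcongr
    _ = (m * x) * (n * z) := by simp only [mul_assoc]
    _ ≤ y * w := mul_le_mul' h h'

theorem ldiv (hS : IsNormalNegative S) (h : BelowMod S x y) (h' : BelowMod S z w) :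
    BelowMod S (ldiv y z) (ldiv x w) := by
  obtain ⟨m, hm, h⟩ := h
  obtain ⟨n, hn, h'⟩ := h'
  obtain ⟨q, hq, hqx⟩ := hS.exists_mul_le_right (n * m) (S.mul_mem hn hm) x
  refine ⟨q, hq, (mul_le_iff_le_ldiv _ _ _).1 ?_⟩
  calc x * (q * ResiduatedLattice.ldiv y z) = (x * q) * ResiduatedLattice.ldiv y z := by
        simp only [mul_assoc]
    _ ≤ n * m * x * ResiduatedLattice.ldiv y z := by gcongr
    _ = n * ((m * x) * ResiduatedLattice.ldiv y z) := by simp only [mul_assoc]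
    _ ≤ n * (y * ResiduatedLattice.ldiv y z) := by gcongr
    _ ≤ n * z := mul_le_mul_right (mul_ldiv_le y z) n
    _ ≤ w := h'

theorem rdiv (hS : IsNormalNegative S) (h : BelowMod S x y) (h' : BelowMod S z w) :
    BelowMod S (rdiv z y) (rdiv w x) := by
  obtain ⟨m, hm, h⟩ := h
  obtain ⟨n, hn, h'⟩ := h'
  obtain ⟨q, hq, hqx⟩ := hS.exists_mul_le_left m hm (ResiduatedLattice.rdiv z y)
  refine ⟨n * q, S.mul_mem hn hq, (mul_le_iff_le_rdiv _ _ _).1 ?_⟩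
  calc n * q * ResiduatedLattice.rdiv z y * x
      = n * (q * ResiduatedLattice.rdiv z y) * x := by simp only [mul_assoc]
    _ ≤ n * (ResiduatedLattice.rdiv z y * m) * x := by gcongr
    _ = n * (ResiduatedLattice.rdiv z y * (m * x)) := by simp only [mul_assoc]
    _ ≤ n * (ResiduatedLattice.rdiv z y * y) := by gcongr
    _ ≤ n * z := mul_le_mul_right (rdiv_mul_le z y) n
    _ ≤ w := h'

end BelowMod

/-- The congruence of a normal submonoid of the negative cone: the symmetric part of
`BelowMod S`. -/
def IsNormalNegative.congruence {S : Submonoid A} (hS : IsNormalNegative S) : Congruence A where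
  r x y := BelowMod S x y ∧ BelowMod S y x
  iseqv := ⟨fun _ => ⟨.of_le le_rfl, .of_le le_rfl⟩, And.symm,
    fun h h' => ⟨h.1.trans h'.1, h'.2.trans h.2⟩⟩
  inf_congr h h' := ⟨h.1.inf hS h'.1, h.2.inf hS h'.2⟩
  sup_congr h h' := ⟨h.1.sup hS h'.1, h.2.sup hS h'.2⟩
  mul_congr h h' := ⟨h.1.mul hS h'.1, h.2.mul hS h'.2⟩
  ldiv_congr h h' := ⟨h.2.ldiv hS h'.1, h.1.ldiv hS h'.2⟩
  rdiv_congr h h' := ⟨h'.2.rdiv hS h.1, h'.1.rdiv hS h.2⟩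

/-- `IsConjugate a b`: the element `b` arises from `a` by one or more applications of left and
right conjugation by elements. -/
inductive IsConjugate (a : A) : A → Prop
  | left (x : A) : IsConjugate a (ldiv x (a * x) ⊓ 1)
  | right (x : A) : IsConjugate a (rdiv (x * a) x ⊓ 1)
  | stepLeft (x : A) {b : A} : IsConjugate a b → IsConjugate a (ldiv x (b * x) ⊓ 1)
  | stepRight (x : A) {b : A} : IsConjugate a b → IsConjugate a (rdiv (x * b) x ⊓ 1)

theorem IsConjugate.le_one {a b : A} (h : IsConjugate a b) : b ≤ 1 := by
  cases h <;> exact inf_le_right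

/-- The submonoid generated by the iterated conjugates of `a`. -/
def conjugateMonoid (a : A) : Submonoid A := Submonoid.closure {b | IsConjugate a b}

theorem isNormalNegative_conjugateMonoid (a : A) : IsNormalNegative (conjugateMonoid a) where
  le_one p hp := by
    induction hp using Submonoid.closure_induction with
    | mem b hb => exact hb.le_one
    | one => exact le_rfl
    | mul b c _ _ hb hc => exact mul_le_one' hb hc
  exists_mul_le_left p hp x := by
    induction hp using Submonoid.closure_induction with
    | mem b hb =>
      exact ⟨_, Submonoid.subset_closure (hb.stepRight x),
        (mul_le_mul_left inf_le_left x).trans (rdiv_mul_le _ x)⟩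
    | one => exact ⟨1, Submonoid.one_mem _, by rw [one_mul, mul_one]⟩
    | mul b c _ _ hb hc =>
      obtain ⟨q, hq, h⟩ := hb
      obtain ⟨r, hr, h'⟩ := hc
      refine ⟨q * r, Submonoid.mul_mem _ hq hr, ?_⟩
      calc q * r * x = q * (r * x) := mul_assoc _ _ _
        _ ≤ q * (x * c) := by gcongr
        _ = q * x * c := (mul_assoc _ _ _).symm
        _ ≤ x * b * c := by gcongr
        _ = x * (b * c) := mul_assoc _ _ _
  exists_mul_le_right p hp x := by
    induction hp using Submonoid.closure_induction with
    | mem b hb =>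
      exact ⟨_, Submonoid.subset_closure (hb.stepLeft x),
        (mul_le_mul_right inf_le_left x).trans (mul_ldiv_le x _)⟩
    | one => exact ⟨1, Submonoid.one_mem _, by rw [one_mul, mul_one]⟩
    | mul b c _ _ hb hc =>
      obtain ⟨q, hq, h⟩ := hb
      obtain ⟨r, hr, h'⟩ := hc
      refine ⟨q * r, Submonoid.mul_mem _ hq hr, ?_⟩
      calc x * (q * r) = x * q * r := (mul_assoc _ _ _).symm
        _ ≤ b * x * r := by gcongr
        _ = b * (x * r) := mul_assoc _ _ _
        _ ≤ b * (c * x) := by gcongr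
        _ = b * c * x := (mul_assoc _ _ _).symm

theorem one_le_of_isTrivial_congruence {a : A}
    (h : (isNormalNegative_conjugateMonoid a).congruence.IsTrivial) : 1 ≤ a := by
  -- Conjugating by `1` shows that `a ∧ 1` itself is a generator, hence congruent to `1`.
  have hmem : a ⊓ 1 ∈ conjugateMonoid a := by
    have h₁ : rdiv (1 * a) 1 ⊓ 1 ∈ conjugateMonoid a := Submonoid.subset_closure (.right 1)
    have h₂ : rdiv (1 * a) 1 = a := by
      apply le_antisymm
      · simpa using rdiv_mul_le (1 * a) 1
      · rw [← mul_le_iff_le_rdiv, one_mul, mul_one]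
    rwa [h₂] at h₁
  exact inf_eq_right.1 (h _ _ ⟨.of_le inf_le_right, a ⊓ 1, hmem, by rw [mul_one]⟩)

/-- If all iterated conjugates of the members of `c` jointly have join `1`, then so do all products
of iterated conjugates. The join is expressed through upper bounds `y`, and the auxiliary `d`
collects the entries of the list that have been replaced already. -/
theorem one_le_of_forall_isConjugate (c : List A) (d : A) (hd : d ≤ 1)
    (h : ∀ g, List.Forall₂ IsConjugate c g → ∀ y, d ≤ y → (∀ t ∈ g, t ≤ y) → 1 ≤ y) :
    ∀ g, List.Forall₂ (fun a p => p ∈ conjugateMonoid a) c g →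
      ∀ y, d ≤ y → (∀ t ∈ g, t ≤ y) → 1 ≤ y := by
  induction c generalizing d with
  | nil =>
    intro g hg
    cases hg
    exact h [] .nil
  | cons a c ih =>
    intro g hg y hdy hgy
    obtain _ | ⟨hp, hg⟩ := hg
    rename_i p g
    rw [List.forall_mem_cons] at hgy
    refine ih (d ⊔ p) (sup_le hd ((isNormalNegative_conjugateMonoid a).le_one p hp)) ?_ g hg y
      (sup_le hdy hgy.1) hgy.2
    clear hgy hdy hg y g
    intro g hg y hdy hgy
    rw [sup_le_iff] at hdy
    have hg1 : ∀ t ∈ g, t ≤ 1 := by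
      clear ih h hgy
      induction hg with
      | nil => simp
      | cons h _ ih => exact List.forall_mem_cons.2 ⟨h.le_one, ih⟩
    obtain ⟨hdy, hpy⟩ := hdy
    induction hp using Submonoid.closure_induction generalizing y with
    | mem b hb => exact h (b :: g) (.cons hb hg) y hdy (List.forall_mem_cons.2 ⟨hpy, hgy⟩)
    | one => exact hpy
    | mul b b' hb _ ihb ihb' =>
      -- If `b b' ≤ y` then `b \ y` is an upper bound of `b'` and of the remaining entries.
      have hb1 := (isNormalNegative_conjugateMonoid a).le_one b hb
      have hby : 1 ≤ ldiv b y := by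
        refine ihb' _ (fun t ht => ?_) ?_ ?_
        · exact (mul_le_iff_le_ldiv _ _ _).1 ((mul_le_of_le_one_left' hb1).trans (hgy t ht))
        · exact (mul_le_iff_le_ldiv _ _ _).1 ((mul_le_of_le_one_left' hb1).trans hdy)
        · exact (mul_le_iff_le_ldiv _ _ _).1 hpy
      exact ihb y hgy hdy (one_le_ldiv_iff.1 hby)

/-- In an FSI residuated lattice, elements whose iterated conjugates always have join `1` cannot
all fail to be above `1`: their conjugate monoids induce congruences with trivial intersection. -/
theorem IsFSI.exists_one_le (hA : IsFSI A) {c : List A} (hc : c ≠ [])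
    (h : ∀ g, List.Forall₂ IsConjugate c g → ∀ y, (∀ t ∈ g, t ≤ y) → 1 ≤ y) :
    ∃ a ∈ c, 1 ≤ a := by
  have key : ∀ x y, (∀ a ∈ c, BelowMod (conjugateMonoid a) x y) → x ≤ y := by
    intro x y hxy
    choose! p hp hpxy using hxy
    have h₁ : ∀ t ∈ c.map p, t ≤ rdiv y x := by
      intro t ht
      obtain ⟨a, ha, rfl⟩ := List.mem_map.1 ht
      exact (mul_le_iff_le_rdiv _ _ _).1 (hpxy a ha)
    -- Any element of `c.map p` may play the part of `d`, as `c` is non-empty.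
    obtain ⟨a, ha⟩ := List.exists_mem_of_ne_nil c hc
    have h₂ := one_le_of_forall_isConjugate c (p a)
      ((isNormalNegative_conjugateMonoid a).le_one _ (hp a ha))
      (fun g hg y _ => h g hg y) (c.map p)
      (List.forall₂_map_right_iff.2 (List.forall₂_same.2 hp)) (rdiv y x)
      (h₁ _ (List.mem_map_of_mem ha)) h₁
    rw [← mul_le_iff_le_rdiv, one_mul] at h₂
    exact h₂
  obtain ⟨θ, hθ, hθt⟩ := hA.exists_isTrivial
    (c.map fun a => (isNormalNegative_conjugateMonoid a).congruence) (by simpa using hc) (by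
      intro x y hxy
      simp only [List.forall_mem_map] at hxy
      exact le_antisymm (key x y fun a ha => (hxy a ha).1) (key y x fun a ha => (hxy a ha).2))
  obtain ⟨a, ha, rfl⟩ := List.mem_map.1 hθ
  exact ⟨a, ha, one_le_of_isTrivial_congruence hθt⟩

end Normal

/-! ### Positive universal sentences and their varieties -/

section Clauses

variable {A : Type u} [ResiduatedLattice A]

theorem PosFormula.holds_iff_clauses (φ : PosFormula) (v : ℕ → A) :
    φ.Holds v ↔ ∀ c ∈ φ.clauses, ∃ p ∈ c, 1 ≤ p.eval v := by
  induction φ with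
  | eq s t =>
    simp [PosFormula.Holds, PosFormula.clauses, Term.eval, one_le_ldiv_iff, le_antisymm_iff]
  | le s t => simp [PosFormula.Holds, PosFormula.clauses, Term.eval, one_le_ldiv_iff]
  | and φ ψ hφ hψ =>
    simp only [PosFormula.Holds, PosFormula.clauses, List.forall_mem_append, hφ, hψ]
  | or φ ψ hφ hψ =>
    simp only [PosFormula.Holds, PosFormula.clauses, hφ, hψ, List.mem_flatMap, List.mem_map]
    constructor
    · rintro h _ ⟨c, hc, d, hd, rfl⟩
      rcases h with h | h
      · obtain ⟨p, hp, h⟩ := h c hc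
        exact ⟨p, List.mem_append_left _ hp, h⟩
      · obtain ⟨p, hp, h⟩ := h d hd
        exact ⟨p, List.mem_append_right _ hp, h⟩
    · intro h
      by_contra! hcon
      obtain ⟨⟨c, hc, hc'⟩, d, hd, hd'⟩ := hcon
      obtain ⟨p, hp, hp'⟩ := h _ ⟨c, hc, d, hd, rfl⟩
      rcases List.mem_append.1 hp with hp | hp
      exacts [hc' p hp hp', hd' p hp hp']

theorem eval_joinTerms_le_iff (v : ℕ → A) (y : A) :
    ∀ {g : List Term}, g ≠ [] → ((joinTerms g).eval v ≤ y ↔ ∀ t ∈ g, t.eval v ≤ y)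
  | [], h => absurd rfl h
  | [t], _ => by simp [joinTerms]
  | t :: s :: l, _ => by
    rw [List.forall_mem_cons, ← eval_joinTerms_le_iff v y (g := s :: l) (by simp)]
    exact sup_le_iff

theorem IsIteratedConjugate.eval_le_one {p t : Term} (h : IsIteratedConjugate p t) (v : ℕ → A) :
    t.eval v ≤ 1 := by
  cases h <;> exact inf_le_right

theorem IsIteratedConjugate.one_le_eval {p t : Term} (h : IsIteratedConjugate p t) (v : ℕ → A)
    (hp : 1 ≤ p.eval v) : 1 ≤ t.eval v := by
  have hl : ∀ (x : ℕ) (s : Term), 1 ≤ s.eval v → 1 ≤ (leftConjugate x s).eval v := fun x s hs =>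
    le_inf (one_le_ldiv_iff.2 (le_mul_of_one_le_left' hs)) le_rfl
  have hr : ∀ (x : ℕ) (s : Term), 1 ≤ s.eval v → 1 ≤ (rightConjugate x s).eval v := fun x s hs =>
    le_inf ((mul_le_iff_le_rdiv _ _ _).1 (by
      rw [one_mul]
      exact le_mul_of_one_le_right' hs)) le_rfl
  induction h with
  | left x => exact hl x _ hp
  | right x => exact hr x _ hp
  | stepLeft x _ ih => exact hl x _ ih
  | stepRight x _ ih => exact hr x _ ih

theorem memVariety_of_satisfies {Φ : Set PosFormula} (h : ∀ φ ∈ Φ, Satisfies A φ) :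
    MemVariety Φ A := by
  intro φ hφ c hc g hg v
  obtain ⟨p, hp, hp1⟩ := (φ.holds_iff_clauses v).1 (h φ hφ v) c hc
  have hne : g ≠ [] := by
    rintro rfl
    cases hg
    exact clauses_ne_nil φ [] hc rfl
  have hle : ∀ t ∈ g, t.eval v ≤ 1 := by
    clear hne hc hp
    induction hg with
    | nil => simp
    | cons h _ ih => exact List.forall_mem_cons.2 ⟨h.eval_le_one v, ih⟩
  have hmem : ∃ t ∈ g, 1 ≤ t.eval v := by
    clear hne hc hle
    induction hg with
    | nil => simp at hp
    | cons h _ ih =>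
      rcases List.mem_cons.1 hp with rfl | hp
      · exact ⟨_, List.mem_cons_self, h.one_le_eval v hp1⟩
      · obtain ⟨t, ht, h⟩ := ih hp
        exact ⟨t, List.mem_cons_of_mem _ ht, h⟩
  obtain ⟨t, ht, h1⟩ := hmem
  refine le_antisymm ?_ ((eval_joinTerms_le_iff v 1 hne).2 hle)
  exact h1.trans ((eval_joinTerms_le_iff v _ hne).1 le_rfl t ht)

/-- A number such that all variables of the term have smaller index. -/
def Term.bound : Term → ℕ
  | .var n => n + 1
  | .one => 0
  | .inf s t => max s.bound t.bound
  | .sup s t => max s.bound t.bound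
  | .mul s t => max s.bound t.bound
  | .ldiv s t => max s.bound t.bound
  | .rdiv s t => max s.bound t.bound

theorem Term.eval_congr {N : ℕ} {v w : ℕ → A} (h : Set.EqOn v w (Set.Iio N)) {t : Term}
    (ht : t.bound ≤ N) : t.eval v = t.eval w := by
  induction t with
  | var n => exact h ht
  | one => rfl
  | _ s t hs ht' =>
    have := max_le_iff.1 ht
    simp only [Term.eval, hs this.1, ht' this.2]

theorem eqOn_update_Iio {A : Type u} (v : ℕ → A) (N : ℕ) (x : A) :
    Set.EqOn v (Function.update v N x) (Set.Iio N) := fun _ hn =>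
  (Function.update_of_ne (ne_of_lt hn) _ _).symm

/-- One conjugation step by an arbitrary element `x` is realized by a fresh variable. -/
theorem exists_conjugate_step {t : Term} {N : ℕ} (v : ℕ → A) (x : A) (ht : t.bound ≤ N) :
    ∃ w : ℕ → A, Set.EqOn v w (Set.Iio N) ∧
      (leftConjugate N t).bound ≤ N + 1 ∧ (rightConjugate N t).bound ≤ N + 1 ∧
      (leftConjugate N t).eval w = ldiv x (t.eval v * x) ⊓ 1 ∧
      (rightConjugate N t).eval w = rdiv (x * t.eval v) x ⊓ 1 := by
  have he := eqOn_update_Iio v N x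
  refine ⟨_, he, ?_, ?_, ?_, ?_⟩
  · simp only [leftConjugate, Term.bound]
    omega
  · simp only [rightConjugate, Term.bound]
    omega
  · simp [leftConjugate, Term.eval, ← Term.eval_congr he ht]
  · simp [rightConjugate, Term.eval, ← Term.eval_congr he ht]

theorem IsConjugate.exists_term {p : Term} {v : ℕ → A} {N : ℕ} (hp : p.bound ≤ N) {b : A}
    (hb : IsConjugate (p.eval v) b) :
    ∃ (t : Term) (w : ℕ → A) (M : ℕ), IsIteratedConjugate p t ∧ N ≤ M ∧ t.bound ≤ M ∧
      Set.EqOn v w (Set.Iio N) ∧ t.eval w = b := by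
  induction hb with
  | left x =>
    obtain ⟨w, hw, hl, -, hl', -⟩ := exists_conjugate_step v x hp
    exact ⟨_, w, N + 1, .left N, N.le_succ, hl, hw, hl'⟩
  | right x =>
    obtain ⟨w, hw, -, hr, -, hr'⟩ := exists_conjugate_step v x hp
    exact ⟨_, w, N + 1, .right N, N.le_succ, hr, hw, hr'⟩
  | stepLeft x _ ih =>
    obtain ⟨t, w, M, hpt, hNM, htM, hvw, rfl⟩ := ih
    obtain ⟨w', hw, hl, -, hl', -⟩ := exists_conjugate_step w x htM
    exact ⟨_, w', M + 1, .stepLeft M hpt, hNM.trans M.le_succ, hl,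
      hvw.trans (hw.mono (Set.Iio_subset_Iio hNM)), hl'⟩
  | stepRight x _ ih =>
    obtain ⟨t, w, M, hpt, hNM, htM, hvw, rfl⟩ := ih
    obtain ⟨w', hw, -, hr, -, hr'⟩ := exists_conjugate_step w x htM
    exact ⟨_, w', M + 1, .stepRight M hpt, hNM.trans M.le_succ, hr,
      hvw.trans (hw.mono (Set.Iio_subset_Iio hNM)), hr'⟩

/-- Iterated conjugates of the values of a list of terms are simultaneously the values of iterated
conjugate terms, under an assignment changed only at fresh variables. -/
theorem exists_terms_of_forall₂_isConjugate (c : List Term) (N : ℕ) (v : ℕ → A)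
    (hc : ∀ p ∈ c, p.bound ≤ N) (g : List A)
    (hg : List.Forall₂ IsConjugate (c.map (Term.eval v)) g) :
    ∃ (G : List Term) (w : ℕ → A), List.Forall₂ IsIteratedConjugate c G ∧
      Set.EqOn v w (Set.Iio N) ∧ G.map (Term.eval w) = g := by
  induction c generalizing N v g with
  | nil =>
    cases hg
    exact ⟨[], v, .nil, fun _ _ => rfl, rfl⟩
  | cons p c ih =>
    rw [List.forall_mem_cons] at hc
    obtain _ | ⟨hb, hg⟩ := hg
    obtain ⟨t, w, M, hpt, hNM, htM, hvw, rfl⟩ := hb.exists_term hc.1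
    have hmap : c.map (Term.eval v) = c.map (Term.eval w) :=
      List.map_congr_left fun q hq => Term.eval_congr hvw (hc.2 q hq)
    rw [hmap] at hg
    obtain ⟨G, w', hG, hww', rfl⟩ := ih M w (fun q hq => (hc.2 q hq).trans hNM) _ hg
    refine ⟨t :: G, w', .cons hpt hG, hvw.trans (hww'.mono (Set.Iio_subset_Iio hNM)), ?_⟩
    rw [List.map_cons, Term.eval_congr hww' htM]

theorem exists_forall_bound_le (c : List Term) : ∃ N, ∀ p ∈ c, p.bound ≤ N := by
  induction c with
  | nil => exact ⟨0, by simp⟩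
  | cons p c ih =>
    obtain ⟨N, hN⟩ := ih
    exact ⟨max p.bound N, List.forall_mem_cons.2
      ⟨le_max_left _ _, fun q hq => (hN q hq).trans (le_max_right _ _)⟩⟩

theorem IsFSI.satisfies (hA : IsFSI A) {Φ : Set PosFormula} (hΦ : MemVariety Φ A)
    {φ : PosFormula} (hφ : φ ∈ Φ) : Satisfies A φ := by
  intro v
  rw [PosFormula.holds_iff_clauses]
  intro c hc
  obtain ⟨N, hN⟩ := exists_forall_bound_le c
  have hne := clauses_ne_nil φ c hc
  obtain ⟨a, ha, ha1⟩ := hA.exists_one_le (c := c.map (Term.eval v)) (by simpa using hne) (by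
    intro g hg y hy
    obtain ⟨G, w, hG, -, rfl⟩ := exists_terms_of_forall₂_isConjugate c N v hN g hg
    have hGne : G ≠ [] := by
      rintro rfl
      cases hG
      exact hne rfl
    have h₁ : 1 = (joinTerms G).eval w := hΦ φ hφ c hc G hG w
    rw [h₁, eval_joinTerms_le_iff w y hGne]
    simpa using hy)
  obtain ⟨p, hp, rfl⟩ := List.mem_map.1 ha
  exact ⟨p, hp, ha1⟩

end Clauses

/-! ### Unilinear and semiunilinear residuated lattices -/

section Unilinear

variable {A : Type u} [ResiduatedLattice A]

/-- Unilinearity as a positive universal sentence in the variables `0, 1, 2, 3`. -/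
def unilinearFormula : PosFormula :=
  .or (.le (.var 0) (.var 1)) (.or (.le (.var 1) (.var 0))
    (.and (.le (.inf (.var 0) (.var 1)) (.var 3)) (.le (.var 2) (.sup (.var 0) (.var 1)))))

theorem satisfies_unilinearFormula_iff : Satisfies A unilinearFormula ↔ IsUnilinear A := by
  constructor
  · intro h u₁ u₂ z w
    exact h fun n => match n with
      | 0 => u₁
      | 1 => u₂
      | 2 => z
      | _ => w
  · exact fun h v => h (v 0) (v 1) (v 2) (v 3)

theorem IsUnilinear.isSemiunilinear (h : IsUnilinear A) : IsSemiunilinear A :=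
  fun _ _ hst => hst A h

/-- The equations attached to `unilinearFormula` hold in all unilinear residuated lattices, hence
throughout the variety these generate; in its FSI members they give back unilinearity. -/
theorem IsSemiunilinear.isUnilinear (h : IsSemiunilinear A) (hA : IsFSI A) : IsUnilinear A := by
  refine satisfies_unilinearFormula_iff.1 (hA.satisfies (Φ := {unilinearFormula}) ?_ rfl)
  intro φ hφ c hc g hg
  refine h _ _ fun B _ hB => memVariety_of_satisfies (Φ := {unilinearFormula}) ?_ φ hφ c hc g hg
  rintro _ rfl
  exact satisfies_unilinearFormula_iff.2 hB

theorem IsSemiunilinear.quot (h : IsSemiunilinear A) (θ : Congruence A) :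
    IsSemiunilinear θ.Quot :=
  fun s t hst => (h s t hst).of_surjective θ.isHom_toQuot θ.toQuot_surjective

/-- A non-trivial congruence identifies `1` with some element strictly below it. -/
theorem Congruence.exists_lt_one {θ : Congruence A} (hθ : ¬ θ.IsTrivial) :
    ∃ a < 1, θ.r a 1 := by
  have key : ∀ x y, θ.r x y → θ.r (ldiv x y ⊓ 1) 1 := by
    intro x y h
    have h₁ := θ.inf_congr (θ.ldiv_congr h (θ.refl y)) (θ.refl 1)
    rwa [ldiv_inf_one_eq_one_iff.2 le_rfl] at h₁
  simp only [Congruence.IsTrivial, not_forall] at hθ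
  obtain ⟨x, y, hxy, hne⟩ := hθ
  by_cases hle : x ≤ y
  · refine ⟨_, lt_of_le_of_ne inf_le_right fun h => ?_, key y x (θ.symm hxy)⟩
    exact hne (hle.antisymm (ldiv_inf_one_eq_one_iff.1 h))
  · exact ⟨_, lt_of_le_of_ne inf_le_right fun h => hle (ldiv_inf_one_eq_one_iff.1 h), key x y hxy⟩

/-- If `1` is the join of two strictly smaller elements `a` and `b` of a unilinear residuated
lattice, then `1` is the top, `a ∧ b` is the bottom, and multiplying by `1 = a ∨ b` shows that
there are no elements besides `a ∧ b`, `a`, `b`, `1`. -/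
theorem IsUnilinear.isFourElementBooleanAlgebra (hA : IsUnilinear A) {a b : A} (ha : a < 1)
    (hb : b < 1) (hab : a ⊔ b = 1) : IsFourElementBooleanAlgebra A := by
  have hnab : ¬ a ≤ b := fun h => hb.ne (by rwa [sup_eq_right.2 h] at hab)
  have hnba : ¬ b ≤ a := fun h => ha.ne (by rwa [sup_eq_left.2 h] at hab)
  have htop : ∀ x : A, x ≤ 1 := fun x => by
    rcases hA a b x x with h | h | h
    exacts [absurd h hnab, absurd h hnba, hab ▸ h.2]
  have hbot : ∀ x : A, a ⊓ b ≤ x := fun x => by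
    rcases hA a b x x with h | h | h
    exacts [absurd h hnab, absurd h hnba, h.1]
  have hmul : ∀ x y : A, x * y ≤ x ⊓ y := fun x y =>
    le_inf (mul_le_of_le_one_right' (htop y)) (mul_le_of_le_one_left' (htop x))
  -- `x = x (y ∨ z) = x y ∨ x z`, where the second joinand is the bottom element.
  have hle : ∀ x y z : A, y ⊔ z = 1 → x ⊓ z ≤ a ⊓ b → x ≤ x * y := fun x y z h₁ h₂ => by
    have h₃ : x * (y ⊔ z) ≤ x * y :=
      mul_sup_le le_rfl (((hmul x z).trans h₂).trans (hbot _))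
    rwa [h₁, mul_one] at h₃
  have hba : b ⊔ a = 1 := by rw [sup_comm, hab]
  have hcases : ∀ x : A, x = a ⊓ b ∨ x = a ∨ x = b ∨ x = 1 := by
    intro x
    rcases hA x a 1 (a ⊓ b) with h | h | ⟨h, h'⟩ <;>
      rcases hA x b 1 (a ⊓ b) with k | k | ⟨k, k'⟩
    · exact .inl ((le_inf h k).antisymm (hbot x))
    · exact absurd (k.trans h) hnba
    · have := hle a x b ((htop _).antisymm k') le_rfl
      exact .inr (.inl (h.antisymm (this.trans ((hmul a x).trans inf_le_right))))
    · exact absurd (h.trans k) hnab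
    · exact .inr (.inr (.inr ((htop x).antisymm (hab ▸ sup_le h k))))
    · have := hle x a b hab k
      exact .inr (.inl ((this.trans ((hmul x a).trans inf_le_right)).antisymm h))
    · have := hle b x a ((htop _).antisymm h') (by rw [inf_comm])
      exact .inr (.inr (.inl (k.antisymm (this.trans ((hmul b x).trans inf_le_right)))))
    · have := hle x b a hba h
      exact .inr (.inr (.inl ((this.trans ((hmul x b).trans inf_le_right)).antisymm k)))
    · have := hle x a b hab k
      have hxa := this.trans ((hmul x a).trans inf_le_right)
      have := hle x b a hba h
      exact .inl ((le_inf hxa (this.trans ((hmul x b).trans inf_le_right))).antisymm (hbot x))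
  have hidem : ∀ x : A, x ≤ x * x := by
    intro x
    rcases hcases x with rfl | rfl | rfl | rfl
    · exact hbot _
    · exact hle _ _ b hab le_rfl
    · exact hle _ _ a hba (by rw [inf_comm])
    · rw [one_mul]
  refine ⟨?_, fun x y => (hmul x y).antisymm
    ((hidem _).trans (mul_le_mul' inf_le_left inf_le_right))⟩
  classical
  have hord : ∀ x y : A, (decide (a ≤ x), decide (b ≤ x)) ≤ (decide (a ≤ y), decide (b ≤ y)) ↔
      x ≤ y := by
    intro x y
    simp only [Prod.mk_le_mk, Bool.le_iff_imp, decide_eq_true_eq]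
    refine ⟨fun ⟨h, h'⟩ => ?_, fun h => ⟨fun k => k.trans h, fun k => k.trans h⟩⟩
    rcases hcases x with rfl | rfl | rfl | rfl
    · exact hbot y
    · exact h le_rfl
    · exact h' le_rfl
    · rw [← hab]
      exact sup_le (h ha.le) (h' hb.le)
  refine ⟨RelIso.ofSurjective (OrderEmbedding.ofMapLEIff _ hord) ?_⟩
  rintro ⟨_ | _, _ | _⟩
  · exact ⟨a ⊓ b, by simp [hnab, hnba]⟩
  · exact ⟨b, by simp [hnab]⟩
  · exact ⟨a, by simp [hnba]⟩
  · exact ⟨1, by simp [ha.le, hb.le]⟩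

theorem IsUnilinear.isFSI (hA : IsUnilinear A) (h4 : ¬ IsFourElementBooleanAlgebra A) :
    IsFSI A := by
  intro θ ψ h
  by_contra! hcon
  obtain ⟨a, ha, ha1⟩ := Congruence.exists_lt_one hcon.1
  obtain ⟨b, hb, hb1⟩ := Congruence.exists_lt_one hcon.2
  refine h4 (hA.isFourElementBooleanAlgebra ha hb (h _ _ ?_ ?_))
  · have := θ.sup_congr ha1 (θ.refl b)
    rwa [sup_eq_left.2 hb.le] at this
  · have := ψ.sup_congr (ψ.refl a) hb1
    rwa [sup_eq_right.2 ha.le] at this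

/-- When multiplication is the meet, every element `a` yields the congruence
`x ⊓ a = y ⊓ a`. -/
def infCongruence (hmul : ∀ x y : A, x * y = x ⊓ y) (a : A) : Congruence A where
  r x y := x ⊓ a = y ⊓ a
  iseqv := ⟨fun _ => rfl, Eq.symm, Eq.trans⟩
  inf_congr {x y z w} h h' := by rw [inf_inf_distrib_right, h, h', ← inf_inf_distrib_right]
  sup_congr {x y z w} h h' := by
    have hd : ∀ s t : A, (s ⊔ t) ⊓ a = (s ⊓ a) ⊔ (t ⊓ a) := fun s t => by
      refine le_antisymm ?_ (le_inf (sup_le_sup inf_le_left inf_le_left)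
        (sup_le inf_le_right inf_le_right))
      rw [← hmul]
      exact sup_mul_le (hmul s a ▸ le_sup_left) (hmul t a ▸ le_sup_right)
    rw [hd, h, h', ← hd]
  mul_congr {x y z w} h h' := by
    rw [hmul, hmul, inf_inf_distrib_right, h, h', ← inf_inf_distrib_right]
  ldiv_congr {x y z w} h h' := by
    refine eq_of_forall_le_iff fun s => ?_
    simp only [le_inf_iff, ← mul_le_iff_le_ldiv, hmul]
    refine and_congr_left fun hs => ?_
    have key : ∀ x z : A, x ⊓ s ≤ z ↔ (x ⊓ a) ⊓ s ≤ z ⊓ a := fun x z => by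
      rw [inf_assoc, inf_eq_right.2 hs, le_inf_iff, and_iff_left (inf_le_right.trans hs)]
    rw [key, h, h', ← key]
  rdiv_congr {x y z w} h h' := by
    refine eq_of_forall_le_iff fun s => ?_
    simp only [le_inf_iff, ← mul_le_iff_le_rdiv, hmul]
    refine and_congr_left fun hs => ?_
    have key : ∀ x z : A, s ⊓ x ≤ z ↔ s ⊓ (x ⊓ a) ≤ z ⊓ a := fun x z => by
      rw [inf_left_comm, inf_eq_left.2 hs, inf_comm x s, le_inf_iff,
        and_iff_left (inf_le_left.trans hs)]
    rw [key, h, h', ← key]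

/-- The two atoms of the four-element Boolean algebra give non-trivial congruences (the kernels of
its projections to the two-element algebra) with trivial intersection. -/
theorem IsFourElementBooleanAlgebra.not_isFSI (h : IsFourElementBooleanAlgebra A) :
    ¬ IsFSI A := by
  obtain ⟨⟨e⟩, hmul⟩ := h
  intro hA
  -- The preimages of the atoms `(true, false)` and `(false, true)` jointly cover everything.
  have hab : ∀ x : A, x ≤ e.symm (true, false) ⊔ e.symm (false, true) := by
    intro x
    rw [← e.symm.map_sup, OrderIso.le_symm_apply]
    exact ⟨le_top, le_top⟩
  have hnontriv : ∀ p : Bool × Bool, p ≠ ⊤ → ¬ (infCongruence hmul (e.symm p)).IsTrivial := by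
    intro p hp ht
    have h₁ := ht (e.symm p) (e.symm ⊤) (by
      change e.symm p ⊓ e.symm p = e.symm ⊤ ⊓ e.symm p
      rw [← e.symm.map_inf, ← e.symm.map_inf, top_inf_eq, inf_idem])
    exact hp (e.symm.injective h₁)
  have hle : ∀ x y : A, x ⊓ e.symm (true, false) = y ⊓ e.symm (true, false) →
      x ⊓ e.symm (false, true) = y ⊓ e.symm (false, true) → x ≤ y := by
    intro x y h₁ h₂
    rw [← inf_eq_left.2 (hab x), ← hmul]
    refine mul_sup_le ?_ ?_
    · rw [hmul, h₁]
      exact inf_le_left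
    · rw [hmul, h₂]
      exact inf_le_left
  rcases hA (infCongruence hmul (e.symm (true, false))) (infCongruence hmul (e.symm (false, true)))
    fun x y h₁ h₂ => (hle x y h₁ h₂).antisymm (hle y x h₁.symm h₂.symm) with h | h
  · exact hnontriv _ (by decide) h
  · exact hnontriv _ (by decide) h

end Unilinear

end ResiduatedLattice

theorem mainTheorem2 :
    (∀ (A : Type u) [ResiduatedLattice A],
      (ResiduatedLattice.IsSemiunilinear A ∧ ResiduatedLattice.IsFSI A) ↔
        (ResiduatedLattice.IsUnilinear A ∧
          ¬ ResiduatedLattice.IsFourElementBooleanAlgebra A)) ∧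
    (∀ (Φ : Set ResiduatedLattice.PosFormula) (A : Type u) [ResiduatedLattice A],
      ((ResiduatedLattice.IsSemiunilinear A ∧ ResiduatedLattice.MemVariety Φ A) ∧
          ResiduatedLattice.IsFSI A) ↔
        (ResiduatedLattice.IsUnilinear A ∧ (∀ φ ∈ Φ, ResiduatedLattice.Satisfies A φ) ∧
          ¬ ResiduatedLattice.IsFourElementBooleanAlgebra A)) ∧
    (∀ (Φ : Set ResiduatedLattice.PosFormula) (A : Type u) [ResiduatedLattice A],
      ResiduatedLattice.IsUnilinear A → (∀ φ ∈ Φ, ResiduatedLattice.Satisfies A φ) →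
        ResiduatedLattice.IsSemiunilinear A ∧ ResiduatedLattice.MemVariety Φ A) ∧
    (∀ (A : Type u) [ResiduatedLattice A], ResiduatedLattice.IsSemiunilinear A →
      ∃ (ι : Type u) (B : ι → Type u) (_ : ∀ i, ResiduatedLattice (B i)),
        (∀ i, ResiduatedLattice.IsUnilinear (B i)) ∧
        ∃ f : A → ∀ i, B i, ResiduatedLattice.IsSubdirectEmbedding f) := by
  refine ⟨fun A _ => ⟨fun h => ?_, fun h => ?_⟩, fun Φ A _ => ⟨fun h => ?_, fun h => ?_⟩,
    fun Φ A _ h hΦ => ?_, fun A _ h => ?_⟩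
  · exact ⟨h.1.isUnilinear h.2, fun h4 => h4.not_isFSI h.2⟩
  · exact ⟨h.1.isSemiunilinear, h.1.isFSI h.2⟩
  · exact ⟨h.1.1.isUnilinear h.2, fun φ hφ => h.2.satisfies h.1.2 hφ,
      fun h4 => h4.not_isFSI h.2⟩
  · exact ⟨⟨h.1.isSemiunilinear, ResiduatedLattice.memVariety_of_satisfies h.2.1⟩,
      h.1.isFSI h.2.2⟩
  · exact ⟨h.isSemiunilinear, ResiduatedLattice.memVariety_of_satisfies hΦ⟩
  · obtain ⟨ι, θ, hθ, hf⟩ := ResiduatedLattice.exists_subdirectEmbedding_isFSI A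
    exact ⟨ι, fun i => (θ i).Quot, inferInstance, fun i => (h.quot (θ i)).isUnilinear (hθ i), _, hf⟩
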